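/- Let $T$ be an Eulerian triangulation, that is, a finite connected simple plane graph (given by its rotation system, with Euler characteristic $2$) in which every face, including the outer one, has size three and every vertex has even degree. Let $V$ be its vertex set, $n=|V|$, and let $a_0,b_0,c_0$ be the three vertices of the outer face. Then the faces of $T$ can be partitioned in exactly one way into two classes $F_1,F_2$ such that no two faces sharing an edge are in the same class and the outer face is in $F_2$. Put $V'=V\setminus\{b_0,c_0\}$; then $|V'|=|F_1|=n-2$. Let $M\in\mathbb{R}^{V'\times F_1}$ be the matrix with $M(v,f)=1$ if the vertex $v$ is incident to the face $f$ and $M(v,f)=0$ otherwise. Then, for all bijections $g_{V'}:\{1,\dots,n-2\}\to V'$ and $g_{F_1}:\{1,\dots,n-2\}\to F_1$ used to index its rows and columns, $\det(M)\neq 0$. Consequently the linear system $$\sum_{f\in F_1,\ f\ni v} x_f=\begin{cases}1 & \text{if } v=a_0,\\ 0 & \text{otherwise,}\end{cases}\qquad v\in V',$$ in the unknowns $(x_f)_{f\in F_1}$ has exactly one real solution. -/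

import Mathlib

/-- A rotation system on a graph `G`: a permutation of the darts (oriented edges) whose cycles are
exactly the sets of darts leaving a common vertex, i.e. a cyclic order of the edges around every
vertex. It encodes a cellular embedding of `G` in an oriented surface. -/
structure RotationSystem {V : Type*} (G : SimpleGraph V) where
  /-- the dart that follows a given dart around its initial vertex -/
  next : Equiv.Perm G.Dart
  next_fst : ∀ d : G.Dart, (next d).fst = d.fst
  sameCycle : ∀ d e : G.Dart, d.fst = e.fst → next.SameCycle d e

namespace RotationSystem

variable {V : Type*} {G : SimpleGraph V}

/-- The face permutation: go along the dart `d`, then turn to the next edge around its end. -/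
def facePerm (T : RotationSystem G) : Equiv.Perm G.Dart :=
  (SimpleGraph.Dart.symm_involutive (G := G)).toPerm.trans T.next

/-- The faces are the cycles of the face permutation. -/
def Face (T : RotationSystem G) : Type _ :=
  Quotient (Equiv.Perm.SameCycle.setoid T.facePerm)

/-- The face whose boundary walk contains the dart `d`. -/
def faceOf (T : RotationSystem G) (d : G.Dart) : T.Face :=
  Quotient.mk (Equiv.Perm.SameCycle.setoid T.facePerm) d

/-- The size of a face is the length of its boundary walk. -/
noncomputable def faceSize (T : RotationSystem G) (f : T.Face) : ℕ :=
  {d : G.Dart | T.faceOf d = f}.ncard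

/-- The vertex `v` is incident to the face `f`. -/
def Incident (T : RotationSystem G) (v : V) (f : T.Face) : Prop :=
  ∃ d : G.Dart, d.fst = v ∧ T.faceOf d = f

/-- Two faces are adjacent if they lie on the two sides of an edge. -/
def FaceAdj (T : RotationSystem G) (f g : T.Face) : Prop :=
  ∃ d : G.Dart, T.faceOf d = f ∧ T.faceOf d.symm = g

/-- The rotation system describes an embedding of a connected graph (with at least one edge) in the
sphere: the surface obtained by gluing a disc to every face has Euler characteristic `2`. -/
def IsPlane (T : RotationSystem G) : Prop :=
  G.Connected ∧ (Nat.card V : ℤ) - (G.edgeSet.ncard : ℤ) + (Nat.card T.Face : ℤ) = 2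

/-- A triangulation is a plane graph all of whose faces have size three. -/
def IsTriangulation (T : RotationSystem G) : Prop :=
  T.IsPlane ∧ ∀ f : T.Face, T.faceSize f = 3

/-- A triangulation is Eulerian if every vertex has even degree. -/
def IsEulerianTriangulation (T : RotationSystem G) : Prop :=
  T.IsTriangulation ∧ ∀ v : V, Even (G.neighborSet v).ncard

/-- `F₁` and its complement split the set of faces so that no two adjacent faces are in the same
part, and the outer face `o` is in the complement of `F₁`. -/
def IsFirstFaceClass (T : RotationSystem G) (o : T.Face) (F₁ : Finset T.Face) : Prop :=
  o ∉ F₁ ∧ ∀ f g : T.Face, T.FaceAdj f g → (f ∈ F₁ ↔ g ∉ F₁)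

open scoped Classical in
/-- The 0/1 incidence matrix with rows `V ∖ {b₀, c₀}` and columns `F₁`. -/
noncomputable def incidenceMatrix (T : RotationSystem G) (b₀ c₀ : V) (F₁ : Finset T.Face) :
    Matrix {v : V // v ≠ b₀ ∧ v ≠ c₀} {f : T.Face // f ∈ F₁} ℝ :=
  Matrix.of fun v f => if T.Incident v.1 f.1 then 1 else 0

open scoped Classical in
/-- `x` solves the size system: for every vertex `v ≠ b₀, c₀`, the sum of `x f` over the faces
`f ∈ F₁` incident to `v` is `1` if `v = a₀` and `0` otherwise. -/
def IsSizeSolution (T : RotationSystem G) (a₀ b₀ c₀ : V) (F₁ : Finset T.Face)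
    (x : {f : T.Face // f ∈ F₁} → ℝ) : Prop :=
  ∀ v : V, v ≠ b₀ → v ≠ c₀ →
    (∑ f : {f : T.Face // f ∈ F₁} with T.Incident v f.1, x f) = if v = a₀ then 1 else 0

end RotationSystem

/-! On a sphere, an antisymmetric function on the darts with zero sum around every face (vertex) is
the difference of a vertex (face) potential. This is a rank count from Euler's formula, valid over
any field: `exists_potential_of_closed`, used for the graph and for its dual. Over `ZMod 2` it
yields the face classes, over `ZMod 3` a vertex colouring showing all three colours on each face.

Euler's formula makes the matrix square, so a trivial kernel suffices. Extend a kernel vector by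
zero to a function `X` on all faces. Each face has one vertex of each colour, so the vertex sums
over any colour class add up to `∑ X`. The class of `a₀` avoids `b₀` and `c₀`, so this total is 0,
and the sums at `b₀` and `c₀` vanish too.

Now `X`, placed on the edges between colours 0 and 2, is a circulation, with a real face potential
`φ`: `X f = φ f - φ f'`, where `f'` lies across that edge of `f ∈ F₁`. Around a vertex of colour 1,
`φ` is constant and the classes alternate, so `∑ φ X = 0` and `∑ φ²` is the same over both classes.
Summing `φ f' ^ 2 = (φ f - X f) ^ 2` over `F₁` leaves `∑ X² = 0`. -/

/-! ### Closed functions are exact: the rank count -/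

open Finset in
/-- On a connected cellular surface of Euler characteristic two, every closed antisymmetric function
on the darts is the coboundary of a potential. Here `u` and `f` send a dart to its vertex and its
face, `α` reverses darts and `s` selects a dart of every edge. -/
theorem exists_potential_of_closed {K D A B E : Type*} [Field K] [Fintype D] [Fintype A]
    [Fintype B] [Nonempty B] [Fintype E] [DecidableEq B] {α : D → D} (hα : Function.Involutive α)
    {u : D → A} {f : D → B} {s : E → D} (hs : ∀ d, ∃ e, d = s e ∨ d = α (s e))
    (hu : ∀ p : A → K, (∀ d, p (u d) = p (u (α d))) → ∀ a b, p a = p b)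
    (hf : ∀ q : B → K, (∀ d, q (f d) = q (f (α d))) → ∀ a b, q a = q b)
    (hcomp : ∀ (p : A → K) (b : B),
      ∑ d with f d = b, p (u d) = ∑ d with f d = b, p (u (α d)))
    (hE : Fintype.card A + Fintype.card B = Fintype.card E + 2)
    {w : D → K} (hw : ∀ d, w (α d) = -w d) (hw0 : ∀ b, ∑ d with f d = b, w d = 0) :
    ∃ p : A → K, ∀ d, w d = p (u d) - p (u (α d)) := by
  classical
  let W : Submodule K (D → K) :=
    { carrier := {w | ∀ d, w (α d) = -w d}
      add_mem' := fun {x y} hx hy d => by simp [hx d, hy d, add_comm]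
      zero_mem' := fun d => by simp
      smul_mem' := fun c x hx d => by simp [hx d] }
  have hWE : Module.finrank K W ≤ Fintype.card E := by
    have hinj : Function.Injective ((LinearMap.funLeft K K s).comp W.subtype) := by
      rw [← LinearMap.ker_eq_bot, LinearMap.ker_eq_bot']
      rintro ⟨x, hx⟩ h
      ext d
      have h' : ∀ e, x (s e) = 0 := fun e => congrFun h e
      obtain ⟨e, rfl | rfl⟩ := hs d
      · exact h' e
      · change x (α (s e)) = 0
        rw [hx, h', neg_zero]
    simpa using LinearMap.finrank_le_finrank_of_injective hinj
  let δ : (A → K) →ₗ[K] W :=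
    { toFun := fun p => ⟨fun d => p (u d) - p (u (α d)), fun d => by simp [hα d]⟩
      map_add' := fun p q => by ext d; simp; ring
      map_smul' := fun c p => by ext d; simp; ring }
  let bd : W →ₗ[K] (B → K) :=
    { toFun := fun x b => ∑ d with f d = b, x.1 d
      map_add' := fun x y => by ext b; simp [sum_add_distrib]
      map_smul' := fun c x => by ext b; simp [mul_sum] }
  have hkerδ : Module.finrank K (LinearMap.ker δ) ≤ 1 := by
    have h1 : (fun _ => 1 : A → K) ∈ LinearMap.ker δ := by
      rw [LinearMap.mem_ker]; ext d; simp [δ]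
    refine finrank_le_one (⟨_, h1⟩ : LinearMap.ker δ) ?_
    rintro ⟨p, hp⟩
    have hc := hu p fun d => sub_eq_zero.mp (congrFun (congrArg Subtype.val hp) d)
    rcases isEmpty_or_nonempty A with hA | ⟨⟨a⟩⟩
    · exact ⟨0, by ext a; exact hA.elim a⟩
    · exact ⟨p a, by ext b; simp [hc a b]⟩
  have hann : Module.finrank K (LinearMap.range bd).dualAnnihilator ≤ 1 := by
    have hform : ∀ ℓ ∈ (LinearMap.range bd).dualAnnihilator, ∀ a b,
        ℓ (Pi.single a 1) = ℓ (Pi.single b 1) := by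
      intro ℓ hℓ
      -- The element `d - α d` of `W` has boundary `f d - f (α d)`, so `ℓ` agrees on adjacent faces.
      refine hf (fun b => ℓ (Pi.single b 1)) fun d => ?_
      have hx : (Pi.single d 1 - Pi.single (α d) 1 : D → K) ∈ W := by
        intro e
        have h1 : α e = d ↔ e = α d := ⟨fun h => by rw [← h, hα], fun h => by rw [h, hα]⟩
        have h2 : α e = α d ↔ e = d := hα.injective.eq_iff
        simp [Pi.single_apply, h1, h2]
      have h := (Submodule.mem_dualAnnihilator ℓ).mp hℓ _ ⟨⟨_, hx⟩, rfl⟩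
      have hb : bd ⟨_, hx⟩ = Pi.single (f d) 1 - Pi.single (f (α d)) 1 := by
        ext b
        change ∑ e with f e = b, ((Pi.single d 1 : D → K) e - (Pi.single (α d) 1 : D → K) e) = _
        rw [sum_sub_distrib, sum_pi_single', sum_pi_single']
        simp [Pi.single_apply, eq_comm]
      rw [hb, map_sub, sub_eq_zero] at h
      exact h
    obtain ⟨b⟩ := ‹Nonempty B›
    by_cases h0 : ∀ ℓ ∈ (LinearMap.range bd).dualAnnihilator, ℓ = 0
    · rw [(Submodule.eq_bot_iff _).mpr h0]; simp
    · push Not at h0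
      obtain ⟨m, hm, hm0⟩ := h0
      have hmb : m (Pi.single b 1) ≠ 0 := by
        intro h
        apply hm0
        refine LinearMap.pi_ext' fun i => LinearMap.ext_ring ?_
        simpa using (hform m hm i b).trans h
      refine finrank_le_one (⟨m, hm⟩ : (LinearMap.range bd).dualAnnihilator) ?_
      rintro ⟨ℓ, hℓ⟩
      refine ⟨ℓ (Pi.single b 1) / m (Pi.single b 1), Subtype.ext ?_⟩
      refine LinearMap.pi_ext' fun i => LinearMap.ext_ring ?_
      simp [hform m hm i b, hform ℓ hℓ i b, hmb]
  have hle : LinearMap.range δ ≤ LinearMap.ker bd := by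
    rintro _ ⟨p, rfl⟩
    rw [LinearMap.mem_ker]
    ext b
    simp [bd, δ, sum_sub_distrib, hcomp p b]
  have e1 := LinearMap.finrank_range_add_finrank_ker δ
  have e2 := LinearMap.finrank_range_add_finrank_ker bd
  have e3 := Subspace.finrank_add_finrank_dualAnnihilator_eq (LinearMap.range bd)
  simp only [Module.finrank_fintype_fun_eq_card] at e1 e3
  -- `dim ker bd ≤ |E| - (|B| - 1) = |A| - 1 ≤ rank δ`.
  have heq := Submodule.eq_of_le_of_finrank_le hle (by omega)
  have hmem : (⟨w, hw⟩ : W) ∈ LinearMap.ker bd := by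
    rw [LinearMap.mem_ker]; ext b; exact hw0 b
  rw [← heq] at hmem
  obtain ⟨p, hp⟩ := hmem
  exact ⟨p, fun d => (congrFun (congrArg Subtype.val hp) d).symm⟩

/-! ### Connectivity and potentials on plane graphs -/

namespace RotationSystem

open Finset

variable {V : Type*} {G : SimpleGraph V} (T : RotationSystem G)

theorem faceOf_facePerm (d : G.Dart) : T.faceOf (T.facePerm d) = T.faceOf d :=
  Quotient.sound (Equiv.Perm.sameCycle_apply_left.mpr (Equiv.Perm.SameCycle.refl _ _))

/-- The face walk through `d.symm` continues with `next d`; thus turning about a vertex crosses one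
edge at a time. -/
theorem faceOf_next (d : G.Dart) : T.faceOf (T.next d) = T.faceOf d.symm := by
  rw [← T.faceOf_facePerm d.symm]
  change _ = T.faceOf (T.next d.symm.symm)
  rw [SimpleGraph.Dart.symm_symm]

theorem fst_facePerm (d : G.Dart) : (T.facePerm d).fst = d.snd :=
  T.next_fst d.symm

theorem faceOf_surjective : Function.Surjective T.faceOf := Quotient.mk_surjective

instance [Finite G.Dart] : Finite T.Face := Finite.of_surjective _ T.faceOf_surjective

variable {T} in
/-- A function that is constant along an orbit of the rotation is constant around the vertex. -/
theorem eq_of_fst_eq {X : Type*} {q : G.Dart → X} {v : V}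
    (h : ∀ d : G.Dart, d.fst = v → q (T.next d) = q d) {d e : G.Dart} (hd : d.fst = v)
    (he : e.fst = v) [Finite G.Dart] : q d = q e := by
  obtain ⟨n, hn⟩ := (T.sameCycle d e (hd.trans he.symm)).exists_nat_pow_eq
  have key : ∀ n : ℕ, ((T.next ^ n) d).fst = v ∧ q ((T.next ^ n) d) = q d := by
    intro n
    induction n with
    | zero => exact ⟨hd, rfl⟩
    | succ n ih =>
      rw [pow_succ', Equiv.Perm.mul_apply]
      exact ⟨(T.next_fst _).trans ih.1, (h _ ih.1).trans ih.2⟩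
  rw [← hn, (key n).2]

variable {T} in
/-- The dual graph of a connected graph is connected: a function on the faces that agrees on
adjacent faces is constant. -/
theorem face_fun_const [Finite G.Dart] (hG : G.Connected) {X : Type*} {q : T.Face → X}
    (h : ∀ d, q (T.faceOf d) = q (T.faceOf d.symm)) (f g : T.Face) : q f = q g := by
  obtain ⟨d, rfl⟩ := T.faceOf_surjective f
  obtain ⟨e, rfl⟩ := T.faceOf_surjective g
  have hrot : ∀ {d e : G.Dart}, d.fst = e.fst → q (T.faceOf d) = q (T.faceOf e) := fun {d e} hde =>
    eq_of_fst_eq (T := T) (q := fun d => q (T.faceOf d)) (v := e.fst)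
      (fun d _ => by simp only [T.faceOf_next, ← h]) hde rfl
  obtain ⟨p⟩ := hG.preconnected d.fst e.fst
  have key : ∀ {v w : V}, G.Walk v w → ∀ d e : G.Dart, d.fst = v → e.fst = w →
      q (T.faceOf d) = q (T.faceOf e) := by
    intro v w p
    induction p with
    | nil => exact fun d e hd he => hrot (hd.trans he.symm)
    | @cons u v w huv p ih =>
      intro d e hd he
      have h1 : q (T.faceOf d) = q (T.faceOf ⟨(u, v), huv⟩) := hrot hd
      rw [h1, h]
      exact ih _ _ rfl he
  exact key p d e rfl rfl

theorem vertex_fun_const (hG : G.Connected) {X : Type*} {q : V → X}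
    (h : ∀ d : G.Dart, q d.fst = q d.snd) (v w : V) : q v = q w := by
  obtain ⟨p⟩ := hG.preconnected v w
  induction p with
  | nil => rfl
  | cons huv _ ih => exact (h ⟨(_, _), huv⟩).trans ih

theorem exists_edge_section (G : SimpleGraph V) :
    ∃ s : G.edgeSet → G.Dart, ∀ d, ∃ e, d = s e ∨ d = (s e).symm := by
  have h : ∀ e : G.edgeSet, ∃ d : G.Dart, d.edge = e := by
    rintro ⟨e, he⟩
    induction e with
    | h x y => exact ⟨⟨(x, y), he⟩, rfl⟩
  choose s hs using h
  exact ⟨s, fun d => ⟨⟨d.edge, d.edge_mem⟩,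
    (SimpleGraph.dart_edge_eq_iff _ _).mp (hs ⟨d.edge, d.edge_mem⟩).symm⟩⟩

variable {T}

theorem card_add_card_face [Fintype V] [Fintype T.Face] [Fintype G.edgeSet] (hT : T.IsPlane) :
    Fintype.card V + Fintype.card T.Face = Fintype.card G.edgeSet + 2 := by
  have h := hT.2
  rw [Nat.card_eq_fintype_card, Nat.card_eq_fintype_card, ← Nat.card_coe_set_eq,
    Nat.card_eq_fintype_card] at h
  omega

theorem sum_next_at [Fintype G.Dart] [DecidableEq V] {M : Type*} [AddCommMonoid M]
    (q : G.Dart → M) (v : V) : ∑ d with d.fst = v, q (T.next d) = ∑ d with d.fst = v, q d := by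
  simp only [sum_filter]
  exact Fintype.sum_equiv T.next _ _ fun d => by simp [T.next_fst]

open scoped Classical in
/-- On a plane graph, an antisymmetric function on the darts with zero sum around every face is the
difference of a potential on the vertices. -/
theorem exists_vertex_potential [Fintype V] [Fintype G.Dart] [Nonempty G.Dart] (hT : T.IsPlane)
    {K : Type*} [Field K] {w : G.Dart → K} (hw : ∀ d, w d.symm = -w d)
    (hw0 : ∀ f, ∑ d with T.faceOf d = f, w d = 0) :
    ∃ p : V → K, ∀ d : G.Dart, w d = p d.fst - p d.snd := by
  obtain ⟨s, hs⟩ := exists_edge_section G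
  have := Fintype.ofFinite T.Face
  have : Nonempty T.Face := .map T.faceOf inferInstance
  refine exists_potential_of_closed (α := SimpleGraph.Dart.symm) (u := fun d : G.Dart => d.fst)
    (f := T.faceOf) SimpleGraph.Dart.symm_involutive hs (fun p h => vertex_fun_const hT.1 h)
    (fun q h => face_fun_const hT.1 h) (fun p f => ?_) (card_add_card_face hT) hw hw0
  simp only [sum_filter]
  refine (Fintype.sum_equiv T.facePerm _ _ fun d => ?_).symm
  rw [T.faceOf_facePerm, T.fst_facePerm]
  rfl

open scoped Classical in
/-- On a plane graph, an antisymmetric function on the darts with zero sum around every vertex is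
the difference of a potential on the faces. -/
theorem exists_face_potential [Fintype V] [Fintype G.Dart] [Nonempty G.Dart] (hT : T.IsPlane)
    {K : Type*} [Field K] {w : G.Dart → K} (hw : ∀ d, w d.symm = -w d)
    (hw0 : ∀ v, ∑ d : G.Dart with d.fst = v, w d = 0) :
    ∃ p : T.Face → K, ∀ d : G.Dart, w d = p (T.faceOf d) - p (T.faceOf d.symm) := by
  obtain ⟨s, hs⟩ := exists_edge_section G
  have := Fintype.ofFinite T.Face
  have : Nonempty V := hT.1.nonempty
  refine exists_potential_of_closed (α := SimpleGraph.Dart.symm) (f := fun d : G.Dart => d.fst)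
    (u := T.faceOf) SimpleGraph.Dart.symm_involutive hs (fun q h => face_fun_const hT.1 h)
    (fun p h => vertex_fun_const hT.1 h) (fun p v => ?_)
    ((add_comm _ _).trans (card_add_card_face hT)) hw hw0
  rw [← sum_next_at (T := T)]
  simp only [T.faceOf_next]

/-! ### Face classes and the vertex colouring -/

open scoped Classical in
theorem card_dart_fst_eq [Fintype G.Dart] (v : V) :
    #{d : G.Dart | d.fst = v} = (G.neighborSet v).ncard := by
  rw [← Nat.card_coe_set_eq, ← Nat.card_eq_finsetCard]
  refine Nat.card_congr ⟨fun d => ⟨d.1.snd, ?_⟩, fun w => ⟨⟨(v, w), w.2⟩, ?_⟩, ?_, ?_⟩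
  · obtain ⟨d, hd⟩ := d
    have hd : d.fst = v := by simpa using hd
    subst hd
    exact d.adj
  · simp
  · rintro ⟨d, hd⟩
    have hd : d.fst = v := by simpa using hd
    subst hd
    rfl
  · intro w; rfl

/-- The faces of an Eulerian triangulation have a proper colouring with two colours. -/
theorem existsUnique_isFirstFaceClass [Finite V] (hT : T.IsEulerianTriangulation) (o : T.Face) :
    ∃! F₁ : Finset T.Face, T.IsFirstFaceClass o F₁ := by
  classical
  have := Fintype.ofFinite V
  have := Fintype.ofFinite T.Face
  have : Nonempty G.Dart := ⟨(T.faceOf_surjective o).choose⟩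
  -- Modulo 2 the constant 1 is antisymmetric, and its vertex sums are the degrees.
  obtain ⟨p, hp⟩ := exists_face_potential (K := ZMod 2) (w := fun _ => 1) hT.1.1
    (fun _ => by decide) (fun v => by
      rw [sum_const, nsmul_one, card_dart_fst_eq, ZMod.natCast_eq_zero_iff_even]; exact hT.2 v)
  refine ⟨({f | p f ≠ p o} : Finset T.Face), ⟨by simp, ?_⟩, fun F hF => ?_⟩
  · rintro _ _ ⟨d, rfl, rfl⟩
    have h := hp d
    simp only [mem_filter_univ]
    generalize p (T.faceOf d) = a at *
    generalize p (T.faceOf d.symm) = b at *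
    generalize p o = c at *
    revert a b c
    decide
  -- Both sides of the equivalence flip across every edge, so its truth value is constant; it holds
  -- at `o`.
  · have hc := face_fun_const (q := fun f => (f ∈ F ↔ p f ≠ p o)) hT.1.1.1 fun d => by
      have h := hp d
      have h2 := hF.2 _ _ ⟨d, rfl, rfl⟩
      simp only [h2]
      generalize p (T.faceOf d) = a at *
      generalize p (T.faceOf d.symm) = b at *
      generalize p o = c at *
      generalize (T.faceOf d.symm ∈ F) = P
      have : a ≠ c ↔ ¬ b ≠ c := by revert a b c; decide
      rw [this, not_iff_not]
    ext f
    have := hc f o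
    simp only [hF.1, ne_eq, not_true_eq_false, eq_iff_iff, iff_true] at this
    simpa using this

theorem IsFirstFaceClass.mem_iff {o : T.Face} {F₁ : Finset T.Face} (hF : T.IsFirstFaceClass o F₁)
    (d : G.Dart) : T.faceOf d ∈ F₁ ↔ T.faceOf d.symm ∉ F₁ :=
  hF.2 _ _ ⟨d, rfl, rfl⟩

open scoped Classical in
/-- A vertex colouring with three colours compatible with a class `F₁` of faces: the colours
decrease cyclically around the faces in `F₁` and increase around the others. -/
def IsCyclicColouring (T : RotationSystem G) (F₁ : Finset T.Face) (col : V → ZMod 3) : Prop :=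
  ∀ d : G.Dart, col d.snd = col d.fst - if T.faceOf d ∈ F₁ then 1 else -1

open scoped Classical in
theorem card_faceOf_eq [Fintype G.Dart] (hT : T.IsTriangulation) (f : T.Face) :
    #{d | T.faceOf d = f} = 3 := by
  rw [← hT.2 f, faceSize, ← Set.ncard_coe_finset]
  simp

/-- The signs `±1` given by the class are opposite on the two sides of an edge and add up to `±3 =
0` around a triangle; their potential is the colouring. -/
theorem exists_isCyclicColouring [Finite V] (hT : T.IsTriangulation) {o : T.Face}
    {F₁ : Finset T.Face} (hF : T.IsFirstFaceClass o F₁) :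
    ∃ col, T.IsCyclicColouring F₁ col := by
  classical
  have := Fintype.ofFinite V
  have : Nonempty G.Dart := ⟨(T.faceOf_surjective o).choose⟩
  obtain ⟨p, hp⟩ := exists_vertex_potential (K := ZMod 3)
    (w := fun d => if T.faceOf d ∈ F₁ then 1 else -1) hT.1 (fun d => by
      have := hF.mem_iff d
      by_cases h : T.faceOf d.symm ∈ F₁ <;> simp [this, h]) (fun f => by
      rw [sum_congr rfl fun d hd => by rw [(mem_filter.mp hd).2], sum_const, card_faceOf_eq hT]
      split_ifs <;> decide)
  exact ⟨p, fun d => by rw [hp d, sub_sub_cancel]⟩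

variable {F₁ : Finset T.Face} {col : V → ZMod 3}

/-- Every face has a vertex of every colour. -/
theorem IsCyclicColouring.exists_dart (hcol : T.IsCyclicColouring F₁ col) (f : T.Face)
    (k : ZMod 3) : ∃ d, T.faceOf d = f ∧ col d.fst = k := by
  classical
  obtain ⟨d, rfl⟩ := T.faceOf_surjective f
  have h1 := hcol d
  have h2 := hcol (T.facePerm d)
  rw [T.fst_facePerm, T.faceOf_facePerm, h1] at h2
  -- A nonzero step generates `ZMod 3`, so three consecutive darts start at all three colours.
  have key : ∀ a e k : ZMod 3, e ≠ 0 → k = a ∨ k = a - e ∨ k = a - e - e := by decide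
  have he : (if T.faceOf d ∈ F₁ then 1 else -1 : ZMod 3) ≠ 0 := by split_ifs <;> decide
  rcases key (col d.fst) _ k he with h | h | h
  · exact ⟨d, rfl, h.symm⟩
  · exact ⟨T.facePerm d, T.faceOf_facePerm d, by rw [T.fst_facePerm, h1, h]⟩
  · exact ⟨T.facePerm (T.facePerm d), by simp only [T.faceOf_facePerm],
      by rw [T.fst_facePerm, h2, h]⟩

/-- The vertices of a face have different colours. -/
theorem IsCyclicColouring.dart_ext [Finite V] (hT : T.IsTriangulation)
    (hcol : T.IsCyclicColouring F₁ col) {d e : G.Dart} (hf : T.faceOf d = T.faceOf e)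
    (hc : col d.fst = col e.fst) : d = e := by
  classical
  have := Fintype.ofFinite V
  have hsurj : Set.SurjOn (fun d : G.Dart => col d.fst)
      ({x | T.faceOf x = T.faceOf e} : Finset G.Dart) (univ : Finset (ZMod 3)) := by
    intro k _
    obtain ⟨x, hx, hk⟩ := hcol.exists_dart (T.faceOf e) k
    exact ⟨x, by simpa using hx, hk⟩
  have hinj := injOn_of_surjOn_of_card_le (fun d : G.Dart => col d.fst)
    (fun _ _ => by simp) hsurj (by rw [card_faceOf_eq hT]; rfl)
  exact hinj (by simpa using hf) (by simp) hc

/-- A sum over the faces is a sum over the darts that leave the vertices of a given colour. -/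
theorem IsCyclicColouring.sum_colour [Finite V] [Fintype G.Dart] [Fintype T.Face]
    (hT : T.IsTriangulation) (hcol : T.IsCyclicColouring F₁ col) (k : ZMod 3) (g : T.Face → ℝ) :
    ∑ d : G.Dart with col d.fst = k, g (T.faceOf d) = ∑ f, g f := by
  refine sum_bij (fun d _ => T.faceOf d) (fun _ _ => mem_univ _) ?_ ?_ fun _ _ => rfl
  · intro d hd e he h
    exact hcol.dart_ext hT h ((mem_filter.mp hd).2.trans (mem_filter.mp he).2.symm)
  · intro f _
    obtain ⟨d, hd, hk⟩ := hcol.exists_dart f k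
    exact ⟨d, by simpa using hk, hd⟩

/-! ### Vanishing vertex sums force zero -/

open scoped Classical in
/-- The columns of the full incidence matrix of vertices and faces in `F₁` are independent. -/
theorem eq_zero_of_vertex_sums_eq_zero [Fintype V] [Fintype G.Dart] (hT : T.IsTriangulation)
    {o : T.Face} (hF : T.IsFirstFaceClass o F₁) (hcol : T.IsCyclicColouring F₁ col)
    {X : T.Face → ℝ} (hX : ∀ f ∉ F₁, X f = 0)
    (hv : ∀ v, ∑ d : G.Dart with d.fst = v, X (T.faceOf d) = 0) : X = 0 := by
  have := Fintype.ofFinite T.Face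
  have : Nonempty G.Dart := ⟨(T.faceOf_surjective o).choose⟩
  have hmem := hF.mem_iff
  -- In a face of `F₁` the dart leaving colour 0 ends at colour 2; elsewhere `X` vanishes.
  let h : G.Dart → ℝ := fun d => if col d.fst = 0 then X (T.faceOf d) else 0
  have hsymm : ∀ d : G.Dart, h d.symm =
      if col d.fst = 2 then X (T.faceOf d.symm) else 0 := by
    intro d
    have hd := hcol d.symm
    simp only [h]
    change (if col d.snd = 0 then _ else _) = _
    change col d.fst = col d.snd - _ at hd
    by_cases hs : T.faceOf d.symm ∈ F₁
    · rw [if_pos hs] at hd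
      have : col d.snd = 0 ↔ col d.fst = 2 := by
        rw [hd]; generalize col d.snd = a; revert a; decide
      simp only [this]
    · simp [hX _ hs]
  -- `h d - h d.symm` is a circulation on the edges between the colours `0` and `2`
  obtain ⟨φ, hφ⟩ := exists_face_potential (T := T) (w := fun d => h d - h d.symm) hT.1
    (fun d => by simp) (fun v => by
      rw [sum_sub_distrib, sub_eq_zero]
      trans 0
      · by_cases hc : col v = 0
        · rw [← hv v]
          exact sum_congr rfl fun d hd => by simp [h, (mem_filter.mp hd).2, hc]
        · exact sum_eq_zero fun d hd => by simp [h, (mem_filter.mp hd).2, hc]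
      · symm
        by_cases hc : col v = 2
        · rw [← hv v, ← sum_next_at (T := T) fun d => X (T.faceOf d)]
          exact sum_congr rfl fun d hd => by
            simp [hsymm, (mem_filter.mp hd).2, hc, T.faceOf_next]
        · exact sum_eq_zero fun d hd => by simp [hsymm, (mem_filter.mp hd).2, hc])
  have hφ0 : ∀ d : G.Dart, col d.fst = 0 →
      X (T.faceOf d) = φ (T.faceOf d) - φ (T.faceOf d.symm) := by
    intro d hd
    rw [← hφ, hsymm]
    simp [h, hd, show (0 : ZMod 3) ≠ 2 by decide]
  -- Edges at a vertex of colour 1 carry no flow.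
  have hφ1 : ∀ d : G.Dart, col d.fst = 1 → φ (T.faceOf (T.next d)) = φ (T.faceOf d) := by
    intro d hd
    have := hφ d
    rw [hsymm] at this
    simp only [h, hd, show (1 : ZMod 3) ≠ 0 by decide, show (1 : ZMod 3) ≠ 2 by decide,
      if_false] at this
    rw [T.faceOf_next]
    linarith
  have hφX : ∑ f, φ f * X f = 0 := by
    rw [← hcol.sum_colour hT 1, ← sum_fiberwise _ fun d : G.Dart => d.fst]
    refine sum_eq_zero fun v _ => ?_
    rw [filter_filter]
    by_cases hc : col v = 1
    · have hset : ({d : G.Dart | col d.fst = 1 ∧ d.fst = v} : Finset G.Dart) =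
          ({d : G.Dart | d.fst = v} : Finset G.Dart) := by
        ext d
        simp only [mem_filter_univ, and_iff_right_iff_imp]
        rintro rfl
        exact hc
      rw [hset]
      rcases isEmpty_or_nonempty {d : G.Dart // d.fst = v} with he | ⟨⟨e, he⟩⟩
      · exact sum_eq_zero fun d hd => (he.false ⟨d, (mem_filter.mp hd).2⟩).elim
      · have hconst : ∀ d ∈ ({d : G.Dart | d.fst = v} : Finset G.Dart),
            φ (T.faceOf d) * X (T.faceOf d) = φ (T.faceOf e) * X (T.faceOf d) := fun d hd => by
          rw [eq_of_fst_eq (T := T) (q := fun d => φ (T.faceOf d)) (v := v)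
            (fun d hd => hφ1 d (by rw [hd, hc])) (mem_filter.mp hd).2 he]
        rw [sum_congr rfl hconst, ← mul_sum, hv, mul_zero]
    · refine sum_eq_zero fun d hd => ?_
      obtain ⟨h1, rfl⟩ := (mem_filter.mp hd).2
      exact (hc h1).elim
  -- One turn about a vertex of colour 1 keeps `φ` and switches the class.
  have hsq : ∑ f, (if f ∈ F₁ then φ f ^ 2 else 0) = ∑ f, (if f ∈ F₁ then 0 else φ f ^ 2) := by
    rw [← hcol.sum_colour hT 1, ← hcol.sum_colour hT 1]
    simp only [sum_filter]
    refine Fintype.sum_equiv T.next _ _ fun d => ?_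
    rw [T.next_fst]
    by_cases hc : col d.fst = 1
    · rw [if_pos hc, if_pos hc, hφ1 d hc, T.faceOf_next]
      by_cases hd : T.faceOf d ∈ F₁
      · rw [if_pos hd, if_neg ((hmem d).mp hd)]
      · rw [if_neg hd, if_pos (not_not.mp (mt (hmem d).mpr hd))]
    · rw [if_neg hc, if_neg hc]
  -- Reversing darts along the edges between colours 0 and 2 pairs `F₁` with its complement.
  have hrefl : ∑ d : G.Dart with col d.fst = 0,
      (if T.faceOf d ∈ F₁ then φ (T.faceOf d.symm) ^ 2 else 0) =
      ∑ f, (if f ∈ F₁ then 0 else φ f ^ 2) := by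
    rw [← hcol.sum_colour hT 2]
    simp only [sum_filter]
    refine Fintype.sum_equiv SimpleGraph.Dart.symm_involutive.toPerm _ _ fun d => ?_
    change _ = if col d.snd = 2 then (if T.faceOf d.symm ∈ F₁ then _ else _) else _
    have hd := hcol d
    by_cases hs : T.faceOf d ∈ F₁
    · rw [if_pos hs] at hd
      have : col d.snd = 2 ↔ col d.fst = 0 := by
        rw [hd]; generalize col d.fst = a; revert a; decide
      simp only [this, hs, (hmem d).mp hs, if_true, if_false]
      rfl
    · have hs' : T.faceOf d.symm ∈ F₁ := not_not.mp (mt (hmem d).mpr hs)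
      simp [hs, hs']
  have henergy : ∑ f, X f ^ 2 = 0 := by
    have hpt : ∀ d ∈ ({d : G.Dart | col d.fst = 0} : Finset G.Dart), X (T.faceOf d) ^ 2 =
        2 * (φ (T.faceOf d) * X (T.faceOf d))
          - (if T.faceOf d ∈ F₁ then φ (T.faceOf d) ^ 2 else 0)
          + (if T.faceOf d ∈ F₁ then φ (T.faceOf d.symm) ^ 2 else 0) := fun d hd => by
      by_cases hs : T.faceOf d ∈ F₁
      · simp only [if_pos hs, hφ0 d (mem_filter.mp hd).2]
        ring
      · simp [hs, hX _ hs]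
    rw [← hcol.sum_colour hT 0, sum_congr rfl hpt, sum_add_distrib, sum_sub_distrib, ← mul_sum,
      hrefl, hcol.sum_colour hT 0 fun f => φ f * X f,
      hcol.sum_colour hT 0 fun f => if f ∈ F₁ then φ f ^ 2 else 0, hφX, hsq]
    ring
  funext f
  have := (sum_eq_zero_iff_of_nonneg fun f _ => sq_nonneg (X f)).mp henergy f (mem_univ f)
  simpa using this

/-- If three vertices have different colours and the sums around the vertices other than two of them
vanish, then the sums around all vertices vanish. -/
theorem vertex_sums_eq_zero [Fintype V] [Fintype G.Dart] [DecidableEq V] (hT : T.IsTriangulation)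
    (hcol : T.IsCyclicColouring F₁ col) {a b c : V} (hab : col a ≠ col b) (hac : col a ≠ col c)
    (hbc : col b ≠ col c) {X : T.Face → ℝ}
    (hv : ∀ v, v ≠ b → v ≠ c → ∑ d : G.Dart with d.fst = v, X (T.faceOf d) = 0) (v : V) :
    ∑ d : G.Dart with d.fst = v, X (T.faceOf d) = 0 := by
  have := Fintype.ofFinite T.Face
  let S : V → ℝ := fun v => ∑ d : G.Dart with d.fst = v, X (T.faceOf d)
  have hclass : ∀ k, ∑ v with col v = k, S v = ∑ f, X f := by
    intro k
    rw [← hcol.sum_colour hT k, ← sum_fiberwise _ fun d : G.Dart => d.fst, sum_filter]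
    refine sum_congr rfl fun v _ => ?_
    rw [filter_filter]
    split_ifs with hc
    · refine sum_congr ?_ fun _ _ => rfl
      ext d
      simp only [mem_filter_univ]
      exact ⟨fun h => ⟨h ▸ hc, h⟩, fun h => h.2⟩
    · refine (sum_eq_zero fun d hd => ?_).symm
      obtain ⟨h1, rfl⟩ := (mem_filter.mp hd).2
      exact (hc h1).elim
  have htotal : ∑ f, X f = 0 := by
    rw [← hclass (col a)]
    refine sum_eq_zero fun v hm => hv v ?_ ?_
    · rintro rfl; exact hab (mem_filter.mp hm).2.symm
    · rintro rfl; exact hac (mem_filter.mp hm).2.symm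
  -- A vertex whose colour class otherwise avoids `b` and `c` carries the whole class sum, which is
  -- 0.
  have hsingle : ∀ v, (∀ w, col w = col v → w ≠ v → w ≠ b ∧ w ≠ c) → S v = 0 := by
    intro v h
    rw [← htotal, ← hclass (col v)]
    exact (sum_eq_single_of_mem v (by simp) fun w hw hne =>
      let h' := h w (mem_filter.mp hw).2 hne
      hv w h'.1 h'.2).symm
  by_cases hvb : v = b
  · subst hvb
    exact hsingle v fun w hw hne => ⟨hne, by rintro rfl; exact hbc hw.symm⟩
  by_cases hvc : v = c
  · subst hvc
    exact hsingle v fun w hw hne => ⟨by rintro rfl; exact hbc hw, hne⟩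
  exact hv v hvb hvc

theorem IsCyclicColouring.ne_of_incident [Finite V] (hT : T.IsTriangulation)
    (hcol : T.IsCyclicColouring F₁ col) {v w : V} {f : T.Face} (hv : T.Incident v f)
    (hw : T.Incident w f) (h : v ≠ w) : col v ≠ col w := by
  obtain ⟨d, rfl, hd⟩ := hv
  obtain ⟨e, rfl, he⟩ := hw
  exact fun hc => h (by rw [hcol.dart_ext hT (hd.trans he.symm) hc])

/-! ### Counting faces and the incidence matrix -/

/-- Every edge has exactly one side in `F₁`, so `F₁` contains `n - 2` of the `2n - 4` faces. -/
theorem card_firstFaceClass [Fintype V] (hT : T.IsTriangulation) {o : T.Face}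
    (hF : T.IsFirstFaceClass o F₁) : F₁.card + 2 = Fintype.card V := by
  classical
  have := Fintype.ofFinite T.Face
  have hcard : ∀ F : Finset T.Face, #{d | T.faceOf d ∈ F} = F.card * 3 := by
    intro F
    rw [card_eq_sum_card_fiberwise (f := T.faceOf) (t := F) fun d hd => by simpa using hd,
      ← smul_eq_mul, ← sum_const]
    refine sum_congr rfl fun f hf => ?_
    rw [← card_faceOf_eq hT f, filter_filter]
    congr 1
    ext d
    simp only [mem_filter_univ]
    exact ⟨fun h => h.2, fun h => ⟨h ▸ hf, h⟩⟩
  have h1 := hcard F₁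
  have h2 := hcard F₁ᶜ
  have h12 : #{d | T.faceOf d ∈ F₁} = #{d | T.faceOf d ∈ F₁ᶜ} := by
    refine card_equiv SimpleGraph.Dart.symm_involutive.toPerm fun d => ?_
    simpa using hF.mem_iff d
  have h3 := SimpleGraph.dart_card_eq_twice_card_edges (G := G)
  have h4 := card_add_card_face hT.1
  have h5 := card_add_card_compl F₁
  have h6 : #{d | T.faceOf d ∈ F₁} + #{d | T.faceOf d ∈ F₁ᶜ} = Fintype.card G.Dart := by
    have := card_filter_add_card_filter_not (s := (univ : Finset G.Dart)) (fun d => T.faceOf d ∈ F₁)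
    simpa using this
  rw [← SimpleGraph.card_edgeSet] at h3
  omega

open scoped Classical in
/-- A face is met exactly once when turning around a vertex. -/
theorem sum_incident_eq [Finite V] [Fintype G.Dart] (hT : T.IsTriangulation)
    (hcol : T.IsCyclicColouring F₁ col) (x : {f : T.Face // f ∈ F₁} → ℝ) (v : V) :
    ∑ f : {f : T.Face // f ∈ F₁} with T.Incident v f.1, x f =
      ∑ d : G.Dart with d.fst = v, if h : T.faceOf d ∈ F₁ then x ⟨T.faceOf d, h⟩ else 0 := by
  symm
  rw [← sum_filter_of_ne (p := fun d => T.faceOf d ∈ F₁)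
    (fun d _ hd => by by_contra h; simp [h] at hd), filter_filter]
  refine sum_bij (fun d hd => ⟨T.faceOf d, (mem_filter.mp hd).2.2⟩) ?_ ?_ ?_ ?_
  · intro d hd
    simpa using ⟨d, (mem_filter.mp hd).2.1, rfl⟩
  · intro d hd e he h
    refine hcol.dart_ext hT (congrArg Subtype.val h) ?_
    rw [(mem_filter.mp hd).2.1, (mem_filter.mp he).2.1]
  · rintro ⟨f, hf⟩ hm
    obtain ⟨d, hd, rfl⟩ := (mem_filter.mp hm).2
    exact ⟨d, by simpa using ⟨hd, hf⟩, rfl⟩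
  · intro d hd
    rw [dif_pos (mem_filter.mp hd).2.2]

open scoped Classical in
theorem incidenceMatrix_mulVec (b c : V) (x : {f : T.Face // f ∈ F₁} → ℝ)
    (v : {v : V // v ≠ b ∧ v ≠ c}) : (T.incidenceMatrix b c F₁).mulVec x v =
      ∑ f : {f : T.Face // f ∈ F₁} with T.Incident v.1 f.1, x f := by
  simp [incidenceMatrix, Matrix.mulVec, dotProduct, sum_filter]

/-- The incidence matrix, with the rows of two vertices of a face deleted, has a trivial kernel. -/
theorem incidenceMatrix_mulVec_injective [Fintype V] (hT : T.IsTriangulation) {o : T.Face}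
    (hF : T.IsFirstFaceClass o F₁) {a b c : V} (ha : T.Incident a o) (hb : T.Incident b o)
    (hc : T.Incident c o) (hab : a ≠ b) (hac : a ≠ c) (hbc : b ≠ c) :
    Function.Injective (T.incidenceMatrix b c F₁).mulVec := by
  classical
  obtain ⟨col, hcol⟩ := exists_isCyclicColouring hT hF
  change Function.Injective (T.incidenceMatrix b c F₁).mulVecLin
  rw [← LinearMap.ker_eq_bot, LinearMap.ker_eq_bot']
  intro x hx
  let X : T.Face → ℝ := fun f => if h : f ∈ F₁ then x ⟨f, h⟩ else 0
  have hX0 : X = 0 := by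
    refine eq_zero_of_vertex_sums_eq_zero hT hF hcol (fun f hf => dif_neg hf) fun v => ?_
    convert vertex_sums_eq_zero hT hcol (hcol.ne_of_incident hT ha hb hab)
      (hcol.ne_of_incident hT ha hc hac) (hcol.ne_of_incident hT hb hc hbc) (X := X)
      (fun v hvb hvc => ?_) v
    have h := congrFun hx ⟨v, hvb, hvc⟩
    rw [Matrix.mulVecLin_apply, incidenceMatrix_mulVec, sum_incident_eq hT hcol] at h
    change _ = (0 : ℝ) at h
    convert h
  ext ⟨f, hf⟩
  simpa [X, hf] using congrFun hX0 f

end RotationSystem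

theorem lemma3 {V : Type*} [Fintype V] [DecidableEq V] (G : SimpleGraph V)
    (T : RotationSystem G) (hT : T.IsEulerianTriangulation)
    (o : T.Face) (a₀ b₀ c₀ : V)
    (ha : T.Incident a₀ o) (hb : T.Incident b₀ o) (hc : T.Incident c₀ o)
    (hab : a₀ ≠ b₀) (hac : a₀ ≠ c₀) (hbc : b₀ ≠ c₀) :
    (∃! F₁ : Finset T.Face, T.IsFirstFaceClass o F₁) ∧
    ∀ F₁ : Finset T.Face, T.IsFirstFaceClass o F₁ →
      Fintype.card {v : V // v ≠ b₀ ∧ v ≠ c₀} = Fintype.card V - 2 ∧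
      F₁.card = Fintype.card V - 2 ∧
      (∀ (gV : Fin (Fintype.card V - 2) ≃ {v : V // v ≠ b₀ ∧ v ≠ c₀})
          (gF : Fin (Fintype.card V - 2) ≃ {f : T.Face // f ∈ F₁}),
        ((T.incidenceMatrix b₀ c₀ F₁).submatrix gV gF).det ≠ 0) ∧
      ∃! x : {f : T.Face // f ∈ F₁} → ℝ, T.IsSizeSolution a₀ b₀ c₀ F₁ x := by
  refine ⟨RotationSystem.existsUnique_isFirstFaceClass hT o, fun F₁ hF => ?_⟩
  have hinj := RotationSystem.incidenceMatrix_mulVec_injective hT.1 hF ha hb hc hab hac hbc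
  have hV : Fintype.card {v : V // v ≠ b₀ ∧ v ≠ c₀} = Fintype.card V - 2 := by
    rw [Fintype.card_subtype,
      show ({v | v ≠ b₀ ∧ v ≠ c₀} : Finset V) = ({b₀, c₀} : Finset V)ᶜ by ext v; simp,
      Finset.card_compl, Finset.card_pair hbc]
  have hF₁ : F₁.card = Fintype.card V - 2 := by
    have := RotationSystem.card_firstFaceClass hT.1 hF
    omega
  refine ⟨hV, hF₁, fun gV gF hdet => ?_, ?_⟩
  · obtain ⟨x, hx0, hx⟩ := Matrix.exists_mulVec_eq_zero_iff.mpr hdet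
    rw [Matrix.submatrix_mulVec_equiv] at hx
    have hzero : (T.incidenceMatrix b₀ c₀ F₁).mulVec (x ∘ gF.symm) = 0 := by
      ext v
      simpa using congrFun hx (gV.symm v)
    have h := hinj (hzero.trans (Matrix.mulVec_zero _).symm)
    refine hx0 (funext fun i => ?_)
    simpa using congrFun h (gF i)
  · have hbij : Function.Bijective (T.incidenceMatrix b₀ c₀ F₁).mulVec := by
      refine ⟨hinj, (LinearMap.injective_iff_surjective_of_finrank_eq_finrank
        (f := (T.incidenceMatrix b₀ c₀ F₁).mulVecLin) ?_).mp hinj⟩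
      simp [hV, hF₁]
    obtain ⟨x, hx, huniq⟩ := hbij.existsUnique fun v => if v.1 = a₀ then 1 else 0
    refine ⟨x, fun v hvb hvc => ?_, fun y hy => huniq y (funext fun v => ?_)⟩
    · have h := congrFun hx ⟨v, hvb, hvc⟩
      rw [RotationSystem.incidenceMatrix_mulVec] at h
      convert h
    · rw [RotationSystem.incidenceMatrix_mulVec]
      convert hy v.1 v.2.1 v.2.2
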